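/- All graphs are finite and simple. For a connected graph $G$ with distance $d$ and eccentricities $\varepsilon(u)=\max_{v} d(u,v)$, the anti-adjacency (eccentricity) matrix $\mathcal A(G)$ is the real symmetric matrix indexed by the vertices of $G$ whose $(u,v)$ entry is $d(u,v)$ if $d(u,v)=\min\{\varepsilon(u),\varepsilon(v)\}$ and $0$ otherwise; its eigenvalues, counted with multiplicity, are the $\mathcal A$-eigenvalues of $G$. For integers $t_0\ge 1$, $p,q\ge 0$ and $t_1,\dots,t_q\ge 2$, let $S(t_0,-p,t_1,\dots,t_q)$ be the mixed extension of the star $K_{1,q+1}$ of type $(t_0,-p,t_1,\dots,t_q)$: the center of the star is replaced by a clique of order $t_0$, one leaf by a coclique of order $p$ (absent if $p=0$), and the remaining leaves by cliques of orders $t_1,\dots,t_q$; two vertices belonging to different parts are adjacent if and only if the corresponding vertices of the star are adjacent. **Theorem 1.1.** A connected graph $G$ has exactly one positive $\mathcal A$-eigenvalue (counted with multiplicity) if and only if $G$ is isomorphic to $S(t_0,-p,t_1,\dots,t_q)$ for some integers $p,q\ge 0$ and $t_j\ge 2$ $(1\le j\le q)$, where one of the following holds: 1. $t_0=1$ and $p+q\ge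 1$; 2. $t_0=2$; 3. $t_0=3$ and $p+q\le 4$; 4. $t_0=4$ and $p+q\le 3$; 5. $t_0\ge 5$ and $p+q\le 2$. -/

import Mathlib

/-- The mixed extension of a graph `G` on the vertex set `ι` of type `t : ι → ℤ`: each vertex `i`
is replaced by a set of `|t i|` new vertices, which is a clique if `t i > 0` and a coclique if
`t i < 0`; vertices in the parts of distinct `i`, `j` are adjacent iff `i`, `j` are adjacent
in `G`. An entry `t i = 0` means that the part of `i` is absent. -/
def mixedExtension {ι : Type*} (G : SimpleGraph ι) (t : ι → ℤ) :
    SimpleGraph (Σ i : ι, Fin (t i).natAbs) where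
  Adj x y := G.Adj x.1 y.1 ∨ (x.1 = y.1 ∧ 0 < t x.1 ∧ x ≠ y)
  symm := ⟨by
    rintro x y (h | ⟨h, hp, hn⟩)
    · exact Or.inl h.symm
    · exact Or.inr ⟨h.symm, h ▸ hp, hn.symm⟩⟩
  loopless := ⟨by
    rintro x (h | ⟨-, -, hn⟩)
    · exact G.irrefl h
    · exact hn rfl⟩

/-- `S(t₀, -p, t₁, …, t_q)`: the mixed extension of the star `K_{1,q+1}` of type
`(t₀, -p, t₁, …, t_q)`, the centre carrying `t₀`. For `p = 0` the coclique is absent. -/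
def starExtension (t₀ p : ℕ) {q : ℕ} (t : Fin q → ℕ) :
    SimpleGraph (Σ i : Fin (q + 2),
      Fin ((Fin.cons (t₀ : ℤ) (Fin.cons (-(p : ℤ)) (fun j => (t j : ℤ))) :
        Fin (q + 2) → ℤ) i).natAbs) :=
  mixedExtension (SimpleGraph.starGraph (0 : Fin (q + 2)))
    (Fin.cons (t₀ : ℤ) (Fin.cons (-(p : ℤ)) (fun j => (t j : ℤ))))

open Classical in
/-- The anti-adjacency (eccentricity) matrix of a graph. -/
noncomputable def antiAdjMatrix {V : Type*} (G : SimpleGraph V) : Matrix V V ℝ :=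
  Matrix.of fun u v =>
    if G.edist u v = min (G.eccent u) (G.eccent v) then (G.dist u v : ℝ) else 0

/-- The multiset of anti-adjacency eigenvalues: the roots of the characteristic polynomial of the
(real symmetric) anti-adjacency matrix, with multiplicity. -/
noncomputable def antiAdjSpectrum {V : Type*} [Fintype V] [DecidableEq V] (G : SimpleGraph V) :
    Multiset ℝ :=
  (antiAdjMatrix G).charpoly.roots

-- Having at most one positive eigenvalue means that the form `x ⬝ᵥ A *ᵥ x` is positive definite on
-- no plane. For a nonnegative matrix with zero diagonal and no zero row, this makes "entry zero" a
-- transitive relation (`apply_eq_zero_trans`). Adjacent vertices of eccentricity at least 2 have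
-- entry 0, so without a dominating vertex connectedness would spread zeros over the whole matrix.
-- Hence a dominating vertex exists, the diameter is at most 2, and the zero classes of the
-- non-dominating vertices are disjoint cliques: `G` is a clique of order t joined to m disjoint
-- cliques.
--
-- For such a graph with m ≥ 2, the form depends only on the sums over the cliques and on the sum of
-- squares over the centre. Completing a square shows that exactly one eigenvalue is positive iff
-- 2(t-1)(m-1) ≤ tm, that is, (t-2)(m-2) ≤ 2. The listed cases are the solutions with m = p + q, the
-- p outer cliques of order 1 forming the coclique.

universe u

/-! ### Positive eigenvalues and quadratic forms -/

open Matrix in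
/-- Coordinates `T x` of a vector in which a symmetric quadratic form is diagonal. -/
theorem Matrix.IsHermitian.exists_diagonalizing_equiv {n : Type*} [Fintype n] [DecidableEq n]
    {A : Matrix n n ℝ} (hA : A.IsHermitian) :
    ∃ T : (n → ℝ) ≃ₗ[ℝ] (n → ℝ), ∀ x, x ⬝ᵥ A *ᵥ x = ∑ i, hA.eigenvalues i * T x i ^ 2 := by
  set P : Matrix n n ℝ := (hA.eigenvectorUnitary : Matrix n n ℝ)
  have h1 : Pᵀ * P = 1 := by
    have := Unitary.coe_star_mul_self hA.eigenvectorUnitary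
    rwa [star_eq_conjTranspose, conjTranspose_eq_transpose_of_trivial] at this
  have h2 : P * Pᵀ = 1 := mul_eq_one_comm.mp h1
  have hspec : A = P * diagonal hA.eigenvalues * Pᵀ := by
    have := hA.spectral_theorem
    rw [Unitary.conjStarAlgAut_apply] at this
    simpa [star_eq_conjTranspose, conjTranspose_eq_transpose_of_trivial, Function.comp_def]
      using this
  refine ⟨Matrix.toLin'OfInv h2 h1, fun x => ?_⟩
  have hT : (Matrix.toLin'OfInv h2 h1) x = Pᵀ *ᵥ x := by simp [Matrix.toLin'OfInv]
  rw [hT]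
  conv_lhs => rw [hspec]
  rw [← mulVec_mulVec, ← mulVec_mulVec, dotProduct_mulVec, ← mulVec_transpose]
  simp only [dotProduct, mulVec_diagonal]
  exact Finset.sum_congr rfl fun i _ => by ring

open Matrix in
theorem Matrix.IsHermitian.card_filter_pos_roots_charpoly {n : Type*} [Fintype n] [DecidableEq n]
    {A : Matrix n n ℝ} (hA : A.IsHermitian) :
    (A.charpoly.roots.filter (fun x : ℝ => 0 < x)).card =
      (Finset.univ.filter fun i => 0 < hA.eigenvalues i).card := by
  rw [hA.roots_charpoly_eq_eigenvalues, Multiset.filter_map, Multiset.card_map]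
  rfl

open Matrix in
theorem Matrix.IsHermitian.card_pos_roots_pos {n : Type*} [Fintype n] [DecidableEq n]
    {A : Matrix n n ℝ} (hA : A.IsHermitian) :
    0 < (A.charpoly.roots.filter (fun x : ℝ => 0 < x)).card ↔ ∃ x, 0 < x ⬝ᵥ A *ᵥ x := by
  obtain ⟨T, hT⟩ := hA.exists_diagonalizing_equiv
  rw [hA.card_filter_pos_roots_charpoly, Finset.card_pos]
  constructor
  · rintro ⟨i, hi⟩
    have hi : 0 < hA.eigenvalues i := by simpa using hi
    refine ⟨T.symm (Pi.single i 1), ?_⟩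
    simpa [hT, Pi.single_apply] using hi
  · rintro ⟨x, hx⟩
    rw [hT] at hx
    obtain ⟨i, -, hi⟩ := Finset.exists_lt_of_sum_lt (by simpa using hx :
      ∑ i : n, (0 : ℝ) < ∑ i, hA.eigenvalues i * T x i ^ 2)
    exact ⟨i, by simpa using pos_of_mul_pos_left hi (sq_nonneg _)⟩

-- Two eigenvectors with positive eigenvalues would span a plane on which the form is positive
-- definite, and every plane meets the kernel of `l` nontrivially.
open Matrix in
theorem Matrix.IsHermitian.card_pos_roots_le_one_of_hyperplane {n : Type*} [Fintype n]
    [DecidableEq n] {A : Matrix n n ℝ} (hA : A.IsHermitian) (l : (n → ℝ) →ₗ[ℝ] ℝ)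
    (h : ∀ x, l x = 0 → x ⬝ᵥ A *ᵥ x ≤ 0) :
    (A.charpoly.roots.filter (fun x : ℝ => 0 < x)).card ≤ 1 := by
  obtain ⟨T, hT⟩ := hA.exists_diagonalizing_equiv
  rw [hA.card_filter_pos_roots_charpoly, Finset.card_le_one]
  intro i hi j hj
  simp only [Finset.mem_filter, Finset.mem_univ, true_and] at hi hj
  by_contra hij
  have key : ∀ a b : ℝ, a * l (T.symm (Pi.single i 1)) + b * l (T.symm (Pi.single j 1)) = 0 →
      hA.eigenvalues i * a ^ 2 + hA.eigenvalues j * b ^ 2 ≤ 0 := by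
    intro a b hab
    have hx := h (T.symm (a • Pi.single i 1 + b • Pi.single j 1)) (by simpa using hab)
    rw [hT, LinearEquiv.apply_symm_apply, ← Finset.add_sum_erase _ _ (Finset.mem_univ i),
      ← Finset.add_sum_erase _ _ (Finset.mem_erase.mpr ⟨Ne.symm hij, Finset.mem_univ j⟩),
      Finset.sum_eq_zero] at hx
    · simpa [Pi.single_apply, hij, Ne.symm hij] using hx
    · intro k hk
      simp only [Finset.mem_erase, Finset.mem_univ, and_true] at hk
      simp [hk.1, hk.2]
  by_cases h0 : l (T.symm (Pi.single i 1)) = 0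
  · have := key 1 0 (by simp [h0])
    simp at this
    linarith
  · have h1 := key (l (T.symm (Pi.single j 1))) (-l (T.symm (Pi.single i 1))) (by ring)
    have h2 : 0 < hA.eigenvalues j * (-l (T.symm (Pi.single i 1))) ^ 2 :=
      mul_pos hj (sq_pos_of_ne_zero (neg_ne_zero.mpr h0))
    have h3 : 0 ≤ hA.eigenvalues i * (l (T.symm (Pi.single j 1))) ^ 2 := by positivity
    linarith

-- Some nontrivial combination kills the only coordinate with a positive eigenvalue. Nontriviality
-- concerns the coefficients, so `v` and `w` need not be independent.
open Matrix in
theorem Matrix.IsHermitian.exists_nonpos_of_card_pos_roots_le_one {n : Type*} [Fintype n]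
    [DecidableEq n] {A : Matrix n n ℝ} (hA : A.IsHermitian)
    (h : (A.charpoly.roots.filter (fun x : ℝ => 0 < x)).card ≤ 1) (v w : n → ℝ) :
    ∃ a b : ℝ, (a ≠ 0 ∨ b ≠ 0) ∧ (a • v + b • w) ⬝ᵥ A *ᵥ (a • v + b • w) ≤ 0 := by
  obtain ⟨T, hT⟩ := hA.exists_diagonalizing_equiv
  rw [hA.card_filter_pos_roots_charpoly] at h
  rcases isEmpty_or_nonempty n with hn | hn
  · exact ⟨1, 0, by simp, by simp⟩
  obtain ⟨i, hi⟩ := Finset.card_le_one_iff_subset_singleton.mp h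
  have key : ∀ x, T x i = 0 → x ⬝ᵥ A *ᵥ x ≤ 0 := by
    intro x hx
    rw [hT]
    refine Finset.sum_nonpos fun j _ => ?_
    by_cases hj : 0 < hA.eigenvalues j
    · have : j = i := by simpa using hi (by simpa using hj)
      simp [this, hx]
    · exact mul_nonpos_of_nonpos_of_nonneg (not_lt.mp hj) (sq_nonneg _)
  by_cases h0 : T v i = 0
  · exact ⟨1, 0, by simp, key _ (by simp [h0])⟩
  · exact ⟨T w i, -T v i, by simp [h0], key _ (by simp; ring)⟩

/-! ### Entries of the anti-adjacency matrix -/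

namespace SimpleGraph

variable {V : Type*} {G : SimpleGraph V}

theorem antiAdjMatrix_comm (u v : V) : antiAdjMatrix G u v = antiAdjMatrix G v u := by
  simp only [antiAdjMatrix, Matrix.of_apply, G.edist_comm (u := u), G.dist_comm (u := u),
    min_comm (G.eccent u)]

theorem antiAdjMatrix_isHermitian : (antiAdjMatrix G).IsHermitian := by
  ext u v
  simp [antiAdjMatrix_comm u v]

theorem antiAdjMatrix_self (u : V) : antiAdjMatrix G u u = 0 := by
  simp [antiAdjMatrix]

theorem antiAdjMatrix_nonneg (u v : V) : 0 ≤ antiAdjMatrix G u v := by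
  simp only [antiAdjMatrix, Matrix.of_apply]
  split_ifs <;> positivity

theorem one_lt_eccent_iff (u : V) : 1 < G.eccent u ↔ ∃ v, u ≠ v ∧ ¬ G.Adj u v := by
  rw [← not_le, eccent_le_one_iff]
  push Not
  rfl

theorem antiAdjMatrix_eq_zero_of_adj {u v : V} (h : G.Adj u v) (hu : 1 < G.eccent u)
    (hv : 1 < G.eccent v) : antiAdjMatrix G u v = 0 := by
  simp only [antiAdjMatrix, Matrix.of_apply]
  rw [if_neg]
  rw [edist_eq_one_iff_adj.mpr h]
  exact (lt_min hu hv).ne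

theorem antiAdjMatrix_eq_one_of_eccent_le_one {u v : V} (huv : u ≠ v) (hu : G.eccent u ≤ 1) :
    antiAdjMatrix G u v = 1 := by
  have hadj := (eccent_le_one_iff u).mp hu v huv
  have h1 := edist_eq_one_iff_adj.mpr hadj
  simp only [antiAdjMatrix, Matrix.of_apply]
  rw [if_pos, dist_eq_one_iff_adj.mpr hadj, Nat.cast_one]
  have h2 : 1 ≤ G.eccent u := h1 ▸ edist_le_eccent
  have h3 : 1 ≤ G.eccent v := by
    rw [← h1, edist_comm]
    exact edist_le_eccent
  rw [h1, min_eq_left (hu.trans h3), le_antisymm hu h2]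

theorem edist_le_two_of_eccent_le_one {c : V} (hc : G.eccent c ≤ 1) (u v : V) :
    G.edist u v ≤ 2 :=
  calc G.edist u v ≤ G.edist u c + G.edist c v := G.edist_triangle
    _ ≤ 1 + 1 := add_le_add ((G.edist_comm ▸ edist_le_eccent).trans hc)
        (edist_le_eccent.trans hc)
    _ = 2 := by norm_num

theorem antiAdjMatrix_eq_two {c u v : V} (hc : G.eccent c ≤ 1) (huv : u ≠ v)
    (h : ¬ G.Adj u v) : antiAdjMatrix G u v = 2 := by
  have hd : G.edist u v = 2 := by
    refine le_antisymm (edist_le_two_of_eccent_le_one hc u v) ?_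
    have : 1 < G.edist u v := by
      rw [← not_le, edist_le_one_iff_adj_or_eq]
      tauto
    simpa [one_add_one_eq_two] using Order.add_one_le_of_lt this
  have he : ∀ x, G.eccent x ≤ 2 := fun x =>
    (eccent_le_iff x 2).mpr fun y => edist_le_two_of_eccent_le_one hc x y
  have hu : G.eccent u = 2 := le_antisymm (he u) (hd ▸ edist_le_eccent)
  have hv : G.eccent v = 2 := le_antisymm (he v) (hd ▸ G.edist_comm ▸ edist_le_eccent)
  simp only [antiAdjMatrix, Matrix.of_apply]
  rw [if_pos (by rw [hd, hu, hv, min_self]), dist, hd]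
  norm_num

/-- A vertex `v` farthest from `u` has eccentricity at least d(u,v) = ε(u), so the minimum is
attained. -/
theorem exists_antiAdjMatrix_pos [Finite V] [Nontrivial V] (hG : G.Connected) (u : V) :
    ∃ v, 0 < antiAdjMatrix G u v := by
  obtain ⟨v, hv⟩ := G.exists_edist_eq_eccent_of_finite u
  refine ⟨v, ?_⟩
  have huv : u ≠ v := by
    rintro rfl
    exact G.eccent_ne_zero u (by rw [← hv, edist_self])
  simp only [antiAdjMatrix, Matrix.of_apply]
  rw [if_pos]
  · exact_mod_cast hG.pos_dist_of_ne huv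
  · rw [eq_comm, hv, min_eq_left_iff, ← hv, edist_comm]
    exact edist_le_eccent

end SimpleGraph

/-! ### Transitivity of the zero pattern and a dominating vertex -/

open Matrix in
/-- A symmetric entrywise nonnegative matrix with zero diagonal, no zero row and at most one
positive eigenvalue is supported on a complete multipartite graph. -/
theorem Matrix.IsHermitian.apply_eq_zero_trans {n : Type*} [Fintype n] [DecidableEq n]
    {A : Matrix n n ℝ} (hA : A.IsHermitian) (h0 : ∀ u, A u u = 0) (hnn : ∀ u v, 0 ≤ A u v)
    (hrow : ∀ u, ∃ v, 0 < A u v)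
    (h : (A.charpoly.roots.filter (fun x : ℝ => 0 < x)).card ≤ 1) {a b c : n}
    (hab : A a b = 0) (hbc : A b c = 0) : A a c = 0 := by
  by_contra hac
  have hs : ∀ u v, A u v = A v u := fun u v => by simpa using hA.apply v u
  obtain ⟨d, hd⟩ := hrow b
  have hac' : 0 < A a c := lt_of_le_of_ne (hnn a c) (Ne.symm hac)
  have hba := (hs b a).trans hab
  have hcb := (hs c b).trans hbc
  -- Since e_b is orthogonal to e_a, e_c and itself, subtracting a multiple of it leaves the value
  -- 2·A a c of the form at e_a + e_c unchanged. The multiple is chosen to make the two vectors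
  -- A-orthogonal.
  obtain ⟨α, β, hne, hle⟩ := hA.exists_nonpos_of_card_pos_roots_le_one h
    (Pi.single a 1 + Pi.single c 1 - ((A a d + A c d) / A b d) • Pi.single b 1)
    (Pi.single b 1 + Pi.single d 1)
  have hQ : ∀ t : ℝ, (α • (Pi.single a 1 + Pi.single c 1 - t • Pi.single b 1) +
      β • (Pi.single b 1 + Pi.single d 1)) ⬝ᵥ A *ᵥ
      (α • (Pi.single a 1 + Pi.single c 1 - t • Pi.single b 1) +
      β • (Pi.single b 1 + Pi.single d 1)) =
      2 * A a c * α ^ 2 + 2 * A b d * β ^ 2 + 2 * α * β * (A a d + A c d - t * A b d) := by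
    intro t
    simp only [mulVec_add, mulVec_sub, mulVec_smul, add_dotProduct, sub_dotProduct, smul_dotProduct,
      dotProduct_add, dotProduct_sub, dotProduct_smul, single_dotProduct, mulVec_single,
      smul_eq_mul, one_mul]
    simp only [h0, hab, hbc, hba, hcb, hs c a, hs d a, hs d b, hs d c, MulOpposite.op_one,
      one_smul, col_apply]
    ring
  rw [hQ, div_mul_cancel₀ _ hd.ne', sub_self, mul_zero, add_zero] at hle
  rcases hne with hα | hβ
  · have : 0 < 2 * A a c * α ^ 2 := by positivity
    have : 0 ≤ 2 * A b d * β ^ 2 := by positivity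
    linarith
  · have : 0 < 2 * A b d * β ^ 2 := by positivity
    have : 0 ≤ 2 * A a c * α ^ 2 := by positivity
    linarith

namespace SimpleGraph

variable {V : Type*} {G : SimpleGraph V}

/-- Otherwise every edge has entry 0, and transitivity along walks makes the whole matrix zero. -/
theorem exists_eccent_le_one [Finite V] [Nontrivial V] (hG : G.Connected)
    (htrans : ∀ {a b c : V}, antiAdjMatrix G a b = 0 → antiAdjMatrix G b c = 0 →
      antiAdjMatrix G a c = 0) : ∃ c, G.eccent c ≤ 1 := by
  by_contra! hall
  have hz : ∀ {u v : V}, G.Walk u v → antiAdjMatrix G u v = 0 := by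
    intro u v p
    induction p with
    | nil => exact antiAdjMatrix_self _
    | cons h _ ih => exact htrans (antiAdjMatrix_eq_zero_of_adj h (hall _) (hall _)) ih
  obtain ⟨u⟩ := hG.nonempty
  obtain ⟨v, hv⟩ := exists_antiAdjMatrix_pos hG u
  obtain ⟨p⟩ := hG.preconnected u v
  exact hv.ne' (hz p)

end SimpleGraph

/-! ### Cliques joined to disjoint unions of cliques -/

namespace SimpleGraph

/-- `h` exhibits `G` as a join of a nonempty clique (the fibre of `none`) with a disjoint union of
nonempty cliques (the other fibres). -/
structure IsConeLabelling {V κ : Type*} (G : SimpleGraph V) (h : V → Option κ) : Prop where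
  adj_iff : ∀ u v, G.Adj u v ↔ u ≠ v ∧ (h u = none ∨ h v = none ∨ h u = h v)
  surjective : Function.Surjective h

namespace IsConeLabelling

variable {V κ : Type*} {G : SimpleGraph V} {h : V → Option κ}

theorem eccent_le_one_of_eq_none (H : G.IsConeLabelling h) {u : V} (hu : h u = none) :
    G.eccent u ≤ 1 :=
  (eccent_le_one_iff u).mpr fun v huv => (H.adj_iff u v).mpr ⟨huv, Or.inl hu⟩

theorem eccent_le_one_of_subsingleton [Subsingleton κ] (H : G.IsConeLabelling h) (u : V) :
    G.eccent u ≤ 1 := by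
  refine (eccent_le_one_iff u).mpr fun v huv => (H.adj_iff u v).mpr ⟨huv, ?_⟩
  rcases hu : h u with _ | k
  · simp
  rcases hv : h v with _ | l
  · simp
  · simp [Subsingleton.elim k l]

theorem one_lt_eccent_of_ne_none [Nontrivial κ] (H : G.IsConeLabelling h) {u : V}
    (hu : h u ≠ none) : 1 < G.eccent u := by
  obtain ⟨k, hk⟩ := Option.ne_none_iff_exists'.mp hu
  obtain ⟨l, hl⟩ := exists_ne k
  obtain ⟨v, hv⟩ := H.surjective (some l)
  have hne : h u ≠ h v := by simpa [hk, hv] using hl.symm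
  refine (one_lt_eccent_iff u).mpr ⟨v, fun huv => hne (by rw [huv]), ?_⟩
  rw [H.adj_iff]
  simp [hk, hv, hl.symm]

-- At least two outer cliques are needed: otherwise the graph is complete and outer vertices too
-- have eccentricity at most 1.
open Classical in
theorem antiAdjMatrix_apply [Nontrivial κ] (H : G.IsConeLabelling h) (u v : V) :
    antiAdjMatrix G u v =
      if h u = none ∨ h v = none then (if u = v then 0 else 1)
      else if h u = h v then 0 else 2 := by
  rcases eq_or_ne u v with rfl | huv
  · simp [antiAdjMatrix_self]
  rw [if_neg huv]
  obtain ⟨c, hc⟩ := H.surjective none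
  split_ifs with h1 h2
  · rcases h1 with h1 | h1
    · exact antiAdjMatrix_eq_one_of_eccent_le_one huv (H.eccent_le_one_of_eq_none h1)
    · rw [antiAdjMatrix_comm]
      exact antiAdjMatrix_eq_one_of_eccent_le_one huv.symm (H.eccent_le_one_of_eq_none h1)
  · push Not at h1
    exact antiAdjMatrix_eq_zero_of_adj ((H.adj_iff u v).mpr ⟨huv, Or.inr (Or.inr h2)⟩)
      (H.one_lt_eccent_of_ne_none h1.1) (H.one_lt_eccent_of_ne_none h1.2)
  · push Not at h1
    refine antiAdjMatrix_eq_two (H.eccent_le_one_of_eq_none hc) huv ?_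
    rw [H.adj_iff]
    tauto

-- The central block is J - I, the mixed blocks are all ones, and the outer block is 2J minus 2J on
-- each clique.
open Classical Matrix in
theorem dotProduct_antiAdjMatrix_mulVec [Fintype V] [Fintype κ] [Nontrivial κ]
    (H : G.IsConeLabelling h) (x : V → ℝ) :
    x ⬝ᵥ antiAdjMatrix G *ᵥ x =
      2 * (∑ k, ∑ u with h u = some k, x u) ^ 2 - 2 * ∑ k, (∑ u with h u = some k, x u) ^ 2
      + 2 * (∑ u with h u = none, x u) * (∑ k, ∑ u with h u = some k, x u)
      + (∑ u with h u = none, x u) ^ 2 - ∑ u with h u = none, x u ^ 2 := by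
  set e : Option κ → V → ℝ := fun j u => if h u = j then 1 else 0 with he
  have hs : ∀ (j : Option κ) (y : V → ℝ), ∑ u with h u = j, y u = ∑ u, e j u * y u := by
    intro j y
    simp [he, Finset.sum_filter]
  have hentry : ∀ u v, x u * antiAdjMatrix G u v * x v =
      2 * ((∑ k, e (some k) u * x u) * (∑ k, e (some k) v * x v))
      - 2 * ∑ k, (e (some k) u * x u) * (e (some k) v * x v)
      + (e none u * x u) * (∑ k, e (some k) v * x v)
      + (∑ k, e (some k) u * x u) * (e none v * x v)
      + (e none u * x u) * (e none v * x v) - if u = v then e none u * x u ^ 2 else 0 := by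
    intro u v
    rw [H.antiAdjMatrix_apply]
    rcases eq_or_ne u v with rfl | huv
    · rcases hu : h u with _ | k
      · simp [he, hu]; ring
      · simp [he, hu]
    · rcases hu : h u with _ | k <;> rcases hv : h v with _ | l
      · simp [he, hu, hv, huv]
      · simp [he, hu, hv, huv]
      · simp [he, hu, hv, huv]
      · rcases eq_or_ne k l with rfl | hkl
        · simp [he, hu, hv, huv]
        · simp [he, hu, hv, huv, hkl]; ring
  have hQ : x ⬝ᵥ antiAdjMatrix G *ᵥ x = ∑ u, ∑ v, x u * antiAdjMatrix G u v * x v := by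
    simp only [dotProduct, mulVec, Finset.mul_sum, mul_assoc]
  have hS : ∑ k, ∑ u, e (some k) u * x u = ∑ u, ∑ k, e (some k) u * x u := Finset.sum_comm
  have hsq : ∑ u, ∑ v, ∑ k, (e (some k) u * x u) * (e (some k) v * x v) =
      ∑ k, (∑ u, e (some k) u * x u) ^ 2 := by
    simp_rw [sq, Finset.sum_mul_sum]
    exact (Finset.sum_congr rfl fun _ _ => Finset.sum_comm).trans Finset.sum_comm
  simp only [hQ, hentry, hs, hS, Finset.sum_add_distrib, Finset.sum_sub_distrib, ← Finset.mul_sum,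
    ← Finset.sum_mul, Finset.sum_ite_eq, Finset.mem_univ, if_true, hsq]
  ring

open Classical in
/-- The number `m` of outer cliques and the order `t` of the central clique decide whether the
anti-adjacency matrix has exactly one positive eigenvalue. -/
theorem card_pos_antiAdjSpectrum_eq_one_iff [Fintype V] [DecidableEq V] [Nontrivial V] [Fintype κ]
    (hG : G.Connected) (H : G.IsConeLabelling h) :
    ((antiAdjSpectrum G).filter (fun x : ℝ => 0 < x)).card = 1 ↔
      2 * (((Finset.univ.filter fun u => h u = none).card : ℝ) - 1) * (Fintype.card κ - 1) ≤
        (Finset.univ.filter fun u => h u = none).card * Fintype.card κ := by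
  set t : ℝ := ((Finset.univ.filter fun u => h u = none).card : ℝ) with ht
  set m : ℝ := (Fintype.card κ : ℝ) with hm
  have hA := antiAdjMatrix_isHermitian (G := G)
  have hpos : 0 < ((antiAdjSpectrum G).filter (fun x : ℝ => 0 < x)).card := by
    rw [antiAdjSpectrum, hA.card_pos_roots_pos]
    obtain ⟨u⟩ := hG.nonempty
    obtain ⟨v, hv⟩ := exists_antiAdjMatrix_pos hG u
    refine ⟨Pi.single u 1 + Pi.single v 1, ?_⟩
    simp only [Matrix.mulVec_add, add_dotProduct, dotProduct_add, single_dotProduct,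
      Matrix.mulVec_single, one_mul, MulOpposite.op_one, one_smul, Matrix.col_apply,
      antiAdjMatrix_self, antiAdjMatrix_comm v u]
    linarith
  have ht1 : 1 ≤ t := by
    obtain ⟨c, hc⟩ := H.surjective none
    have : 0 < (Finset.univ.filter fun u => h u = none).card :=
      Finset.card_pos.mpr ⟨c, by simp [hc]⟩
    rw [ht]
    exact_mod_cast this
  have hle : ((antiAdjSpectrum G).filter (fun x : ℝ => 0 < x)).card = 1 ↔
      ((antiAdjSpectrum G).filter (fun x : ℝ => 0 < x)).card ≤ 1 := by omega
  rw [hle]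
  rcases subsingleton_or_nontrivial κ with hκ | hκ
  · have hm1 : m ≤ 1 := by
      rw [hm]
      exact_mod_cast Fintype.card_le_one_iff_subsingleton.mpr hκ
    have hm0 : 0 ≤ m := Nat.cast_nonneg _
    refine iff_of_true ?_ (by nlinarith)
    -- The graph is complete, so the matrix is J - I, which acts as -I on vectors of sum zero.
    refine hA.card_pos_roots_le_one_of_hyperplane (∑ u, LinearMap.proj u) fun x hx => ?_
    have hx : ∑ u, x u = 0 := by simpa using hx
    have hQ : ∀ u, ∑ v, antiAdjMatrix G u v * x v = - x u := by
      intro u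
      have : ∀ v, antiAdjMatrix G u v * x v = x v - if u = v then x v else 0 := by
        intro v
        split_ifs with huv
        · simp [huv, antiAdjMatrix_self]
        · simp [antiAdjMatrix_eq_one_of_eccent_le_one huv (H.eccent_le_one_of_subsingleton u)]
      simp [this, hx]
    simp only [dotProduct, Matrix.mulVec, hQ]
    exact Finset.sum_nonpos fun u _ => by nlinarith [sq_nonneg (x u)]
  · have hm2 : 2 ≤ m := by
      rw [hm]
      exact_mod_cast Fintype.one_lt_card_iff_nontrivial.mpr hκ
    constructor
    · intro hcard
      by_contra! hlt
      set n : κ → ℝ := fun k => ((Finset.univ.filter fun u => h u = some k).card : ℝ)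
      have hn0 : ∀ k, n k ≠ 0 := by
        intro k
        obtain ⟨c, hc⟩ := H.surjective (some k)
        have : 0 < (Finset.univ.filter fun u => h u = some k).card :=
          Finset.card_pos.mpr ⟨c, by simp [hc]⟩
        exact Nat.cast_ne_zero.mpr this.ne'
      -- The plane is spanned by the indicator of the centre and the vector with sum 1, spread
      -- evenly, on every outer clique. Such vectors are extremal for the Cauchy–Schwarz bounds of
      -- the converse.
      obtain ⟨a, b, hab, hQ⟩ := hA.exists_nonpos_of_card_pos_roots_le_one hcard
        (fun u => (h u).elim 1 fun _ => 0) (fun u => (h u).elim 0 fun k => (n k)⁻¹)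
      set x : V → ℝ := (a • fun u => (h u).elim 1 fun _ => 0) +
        (b • fun u => (h u).elim 0 fun k => (n k)⁻¹) with hx
      have hnone : ∀ u, h u = none → x u = a := by
        intro u hu
        simp [hx, hu]
      have hsome : ∀ k u, h u = some k → x u = b * (n k)⁻¹ := by
        intro k u hu
        simp [hx, hu]
      have h1 : ∑ u with h u = none, x u = t * a := by
        rw [Finset.sum_congr rfl fun u hu => hnone u (by simpa using hu)]
        simp [ht]
      have h2 : ∑ u with h u = none, x u ^ 2 = t * a ^ 2 := by
        rw [Finset.sum_congr rfl fun u hu => by rw [hnone u (by simpa using hu)]]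
        simp [ht]
      have h3 : ∀ k, ∑ u with h u = some k, x u = b := by
        intro k
        rw [Finset.sum_congr rfl fun u hu => hsome k u (by simpa using hu), Finset.sum_const,
          nsmul_eq_mul, mul_left_comm, mul_inv_cancel₀ (hn0 k), mul_one]
      rw [H.dotProduct_antiAdjMatrix_mulVec, h1, h2] at hQ
      simp only [h3, Finset.sum_const, Finset.card_univ, nsmul_eq_mul, ← hm] at hQ
      -- Completing the square in b; the remaining coefficient of a² is positive exactly when the
      -- inequality fails.
      have hsq : m * (2 * m ^ 2 * b ^ 2 - 2 * m * b ^ 2 + 2 * t * m * a * b +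
          t ^ 2 * a ^ 2 - t * a ^ 2) * (2 * (m - 1)) =
          (2 * m * (m - 1) * b + t * m * a) ^ 2 +
          t * m * (2 * (t - 1) * (m - 1) - t * m) * a ^ 2 := by ring
      have hle0 : m * (2 * m ^ 2 * b ^ 2 - 2 * m * b ^ 2 + 2 * t * m * a * b +
          t ^ 2 * a ^ 2 - t * a ^ 2) * (2 * (m - 1)) ≤ 0 :=
        mul_nonpos_of_nonpos_of_nonneg
          (mul_nonpos_of_nonneg_of_nonpos (by linarith) (by linarith)) (by linarith)
      have hD : 0 < t * m * (2 * (t - 1) * (m - 1) - t * m) :=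
        mul_pos (mul_pos (by linarith) (by linarith)) (by linarith)
      have ha : a = 0 := by
        by_contra ha
        have : 0 < t * m * (2 * (t - 1) * (m - 1) - t * m) * a ^ 2 := by positivity
        nlinarith [sq_nonneg (2 * m * (m - 1) * b + t * m * a)]
      have hb : b ≠ 0 := by tauto
      have hc : 2 * m * (m - 1) * b ≠ 0 :=
        mul_ne_zero (mul_ne_zero (by linarith) (by linarith)) hb
      have : 0 < (2 * m * (m - 1) * b) ^ 2 := by positivity
      rw [hsq, ha] at hle0
      linarith
    · intro hle
      -- This hyperplane is the A-orthogonal complement of any vector supported outside the centre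
      -- with sum 1 on each outer clique.
      refine hA.card_pos_roots_le_one_of_hyperplane
        (m • (∑ u with h u = none, LinearMap.proj u) +
          (2 * (m - 1)) • ∑ k, ∑ u with h u = some k, LinearMap.proj u) fun x hx => ?_
      rw [H.dotProduct_antiAdjMatrix_mulVec]
      have hx : m * (∑ u with h u = none, x u) +
          2 * (m - 1) * ∑ k, ∑ u with h u = some k, x u = 0 := by
        simpa using hx
      have hc1 : (∑ u with h u = none, x u) ^ 2 ≤ t * ∑ u with h u = none, x u ^ 2 :=
        sq_sum_le_card_mul_sum_sq
      have hc2 : (∑ k, ∑ u with h u = some k, x u) ^ 2 ≤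
          m * ∑ k, (∑ u with h u = some k, x u) ^ 2 := by
        simpa using sq_sum_le_card_mul_sum_sq (s := (Finset.univ : Finset κ))
          (f := fun k => ∑ u with h u = some k, x u)
      generalize (∑ u with h u = none, x u) = s0 at *
      generalize (∑ k, ∑ u with h u = some k, x u) = S at *
      generalize (∑ k, (∑ u with h u = some k, x u) ^ 2) = W at *
      generalize (∑ u with h u = none, x u ^ 2) = Z at *
      have hZ : s0 ^ 2 / t ≤ Z := by rwa [div_le_iff₀' (by linarith)]
      have hW : S ^ 2 / m ≤ W := by rwa [div_le_iff₀' (by linarith)]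
      have hs0 : s0 = -(2 * (m - 1) * S) / m := by
        rw [eq_div_iff (by linarith)]
        linarith
      calc 2 * S ^ 2 - 2 * W + 2 * s0 * S + s0 ^ 2 - Z
          ≤ 2 * S ^ 2 - 2 * (S ^ 2 / m) + 2 * s0 * S + s0 ^ 2 - s0 ^ 2 / t := by linarith
        _ = S ^ 2 * (2 * (m - 1)) / (m ^ 2 * t) * (2 * (t - 1) * (m - 1) - t * m) := by
          rw [hs0]
          field_simp
          ring
        _ ≤ 0 := by
          refine mul_nonpos_of_nonneg_of_nonpos (div_nonneg (mul_nonneg (sq_nonneg _) ?_) ?_) ?_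
          · linarith
          · positivity
          · linarith

end IsConeLabelling

/-- Off the diagonal, two non-dominating vertices have entry 0 if adjacent and 2 if not, so their
zero classes are cliques with no edges between them. Dominating vertices form the centre. -/
theorem exists_isConeLabelling {V : Type u} {G : SimpleGraph V} {c : V} (hc : G.eccent c ≤ 1)
    (htrans : ∀ {a b c : V}, antiAdjMatrix G a b = 0 → antiAdjMatrix G b c = 0 →
      antiAdjMatrix G a c = 0) :
    ∃ (κ : Type u) (h : V → Option κ), G.IsConeLabelling h := by
  classical
  let s : Setoid {u : V // ¬ G.eccent u ≤ 1} :=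
    { r := fun u v => antiAdjMatrix G u v = 0
      iseqv := ⟨fun u => antiAdjMatrix_self _, fun h => by rwa [antiAdjMatrix_comm], htrans⟩ }
  refine ⟨Quotient s, fun u => if hu : G.eccent u ≤ 1 then none else some ⟦⟨u, hu⟩⟧, ?_, ?_⟩
  · intro u v
    by_cases hu : G.eccent u ≤ 1
    · simp only [hu, dif_pos, true_or, and_true]
      exact ⟨fun h => h.ne, fun h => (eccent_le_one_iff u).mp hu v h⟩
    by_cases hv : G.eccent v ≤ 1
    · simp only [hv, dif_pos, true_or, or_true, and_true]
      exact ⟨fun h => h.ne, fun h => ((eccent_le_one_iff v).mp hv u h.symm).symm⟩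
    simp only [hu, hv, dif_neg, not_false_eq_true, reduceCtorEq, false_or, Option.some.injEq,
      Quotient.eq]
    change _ ↔ u ≠ v ∧ antiAdjMatrix G u v = 0
    refine ⟨fun h => ⟨h.ne, antiAdjMatrix_eq_zero_of_adj h (not_le.mp hu) (not_le.mp hv)⟩, ?_⟩
    rintro ⟨huv, h0⟩
    by_contra hadj
    rw [antiAdjMatrix_eq_two hc huv hadj] at h0
    norm_num at h0
  · rintro (_ | k)
    · exact ⟨c, by simp [hc]⟩
    · obtain ⟨⟨u, hu⟩, rfl⟩ := Quotient.exists_rep k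
      exact ⟨u, by simp [hu]⟩

end SimpleGraph

/-! ### Identification with mixed extensions of stars -/

namespace SimpleGraph

namespace IsConeLabelling

variable {V V' κ κ' : Type*} {G : SimpleGraph V} {G' : SimpleGraph V'} {h : V → Option κ}
  {h' : V' → Option κ}

theorem comp_iso (H : G'.IsConeLabelling h') (e : G ≃g G') : G.IsConeLabelling (h' ∘ e) where
  adj_iff u v := by
    rw [← e.map_adj_iff, H.adj_iff, Function.comp_apply, Function.comp_apply, e.injective.ne_iff]
  surjective := H.surjective.comp e.surjective

theorem relabel (H : G.IsConeLabelling h) (e : κ ≃ κ') :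
    G.IsConeLabelling (e.optionCongr ∘ h) where
  adj_iff u v := by
    rw [H.adj_iff, Function.comp_apply, Function.comp_apply, e.optionCongr.injective.eq_iff]
    simp
  surjective := e.optionCongr.surjective.comp H.surjective

/-- A cone labelling determines the graph up to the orders of its fibres. -/
theorem nonempty_iso [Finite V] [Finite V'] (H : G.IsConeLabelling h) (H' : G'.IsConeLabelling h')
    (hcard : ∀ k, Nat.card {u // h u = k} = Nat.card {u // h' u = k}) : Nonempty (G ≃g G') := by
  let f := fun k => Classical.choice (Finite.card_eq.mp (hcard k))
  let e : V ≃ V' := (Equiv.sigmaFiberEquiv h).symm.trans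
    ((Equiv.sigmaCongrRight f).trans
      (Equiv.sigmaFiberEquiv h'))
  have he : ∀ u, h' (e u) = h u := fun u => (f (h u) ⟨u, rfl⟩).2
  refine ⟨⟨e, fun {u v} => ?_⟩⟩
  rw [H.adj_iff, H'.adj_iff, he, he, e.injective.ne_iff]

end IsConeLabelling

/-- The part of a vertex of `starExtension t₀ p t`, each vertex of the coclique being a part of its
own. -/
def starLabel (t₀ p : ℕ) {q : ℕ} (t : Fin q → ℕ) (x : Σ i : Fin (q + 2),
      Fin ((Fin.cons (t₀ : ℤ) (Fin.cons (-(p : ℤ)) (fun j => (t j : ℤ))) :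
        Fin (q + 2) → ℤ) i).natAbs) : Option (Fin p ⊕ Fin q) :=
  Fin.cases (motive := fun i => Fin ((Fin.cons (t₀ : ℤ) (Fin.cons (-(p : ℤ))
      (fun j => (t j : ℤ))) : Fin (q + 2) → ℤ) i).natAbs → Option (Fin p ⊕ Fin q))
    (fun _ => none)
    (Fin.cases (fun y => some (Sum.inl (Fin.cast (by simp) y))) fun j _ => some (Sum.inr j)) x.1 x.2

section starLabel

variable (t₀ p : ℕ) {q : ℕ} (t : Fin q → ℕ)

@[simp]
theorem starLabel_zero (y) : starLabel t₀ p t ⟨0, y⟩ = none := rfl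

@[simp]
theorem starLabel_one (y) :
    starLabel t₀ p t ⟨Fin.succ 0, y⟩ = some (Sum.inl (Fin.cast (by simp) y)) := rfl

@[simp]
theorem starLabel_succ_succ (j : Fin q) (y) :
    starLabel t₀ p t ⟨j.succ.succ, y⟩ = some (Sum.inr j) := rfl

theorem card_starLabel_none : Nat.card {x // starLabel t₀ p t x = none} = t₀ := by
  classical
  rw [Nat.card_eq_fintype_card, Fintype.card_subtype, Finset.card_filter, Fintype.sum_sigma,
    Fin.sum_univ_succ, Fin.sum_univ_succ]
  simp [-Fin.succ_zero_eq_one]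

theorem card_starLabel_inl (a : Fin p) :
    Nat.card {x // starLabel t₀ p t x = some (Sum.inl a)} = 1 := by
  rw [Nat.card_eq_one_iff_exists]
  refine ⟨⟨⟨Fin.succ 0, Fin.cast (by simp) a⟩, by simp [-Fin.succ_zero_eq_one]⟩, ?_⟩
  rintro ⟨⟨i, x⟩, hx⟩
  induction i using Fin.cases with
  | zero => simp at hx
  | succ i =>
    induction i using Fin.cases with
    | zero =>
      have : Fin.cast (by simp) x = a := by simpa [-Fin.succ_zero_eq_one] using hx
      subst this
      rfl
    | succ i => simp at hx

theorem card_starLabel_inr (j : Fin q) :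
    Nat.card {x // starLabel t₀ p t x = some (Sum.inr j)} = t j := by
  classical
  rw [Nat.card_eq_fintype_card, Fintype.card_subtype, Finset.card_filter, Fintype.sum_sigma,
    Fin.sum_univ_succ, Fin.sum_univ_succ]
  simp [-Fin.succ_zero_eq_one]

variable {t₀ t}

theorem isConeLabelling_starLabel (h₀ : 1 ≤ t₀) (ht : ∀ j, 2 ≤ t j) :
    (starExtension t₀ p t).IsConeLabelling (starLabel t₀ p t) where
  adj_iff := by
    rintro ⟨i, x⟩ ⟨j, y⟩
    simp only [starExtension, mixedExtension, starGraph_adj]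
    induction i using Fin.cases with
    | zero =>
      induction j using Fin.cases with
      | zero => simp; omega
      | succ j => simp [(Fin.succ_ne_zero j).symm]
    | succ i =>
      induction j using Fin.cases with
      | zero => simp
      | succ j =>
        induction i using Fin.cases with
        | zero =>
          induction j using Fin.cases with
          | zero => simp [-Fin.succ_zero_eq_one]
          | succ j => simp [-Fin.succ_zero_eq_one]
        | succ i =>
          induction j using Fin.cases with
          | zero =>
            have hne : i.succ.succ ≠ 1 := (Fin.succ_injective _).ne (Fin.succ_ne_zero i)
            simp [-Fin.succ_zero_eq_one, hne]
          | succ j =>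
            have hpos : 0 < t i := by have := ht i; omega
            simp [hpos]
            tauto
  surjective := by
    have key : ∀ k, Nat.card {x // starLabel t₀ p t x = k} ≠ 0 := by
      rintro (_ | a | j)
      · rw [card_starLabel_none]; omega
      · rw [card_starLabel_inl]; omega
      · rw [card_starLabel_inr]; have := ht j; omega
    intro k
    obtain ⟨⟨x, hx⟩⟩ := (Nat.card_ne_zero.mp (key k)).1
    exact ⟨x, hx⟩

end starLabel

/-- Outer fibres with one vertex are collected into the coclique; the others have order at least 2
and become the cliques. -/
theorem IsConeLabelling.exists_iso_starExtension {V κ : Type*} [Finite V] [Finite κ]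
    {G : SimpleGraph V} {h : V → Option κ} (H : G.IsConeLabelling h) :
    ∃ (p q : ℕ) (t : Fin q → ℕ), (∀ j, 2 ≤ t j) ∧ p + q = Nat.card κ ∧
      Nonempty (G ≃g starExtension (Nat.card {u // h u = none}) p t) := by
  classical
  set n : Option κ → ℕ := fun k => Nat.card {u // h u = k}
  have hn0 : ∀ k, n k ≠ 0 := fun k =>
    have ⟨u, hu⟩ := H.surjective k
    Nat.card_ne_zero.mpr ⟨⟨u, hu⟩, inferInstance⟩
  let e₁ := Finite.equivFin {k : κ // n (some k) = 1}
  let e₂ := Finite.equivFin {k : κ // ¬ n (some k) = 1}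
  let e : κ ≃ Fin _ ⊕ Fin _ :=
    (Equiv.sumCompl fun k => n (some k) = 1).symm.trans (Equiv.sumCongr e₁ e₂)
  have ht : ∀ j, 2 ≤ n (some (e₂.symm j)) := fun j => by
    have := hn0 (some (e₂.symm j))
    have := (e₂.symm j).2
    omega
  refine ⟨Nat.card {k : κ // n (some k) = 1}, _, fun j => n (some (e₂.symm j)), ht, ?_, ?_⟩
  · rw [Nat.card_congr e]
    simp
  · refine (H.relabel e).nonempty_iso
      (isConeLabelling_starLabel _ (Nat.one_le_iff_ne_zero.mpr (hn0 none)) ht) fun k => ?_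
    have hk : Nat.card {u // (e.optionCongr ∘ h) u = k} = n (e.optionCongr.symm k) :=
      Nat.card_congr (Equiv.subtypeEquivRight fun u => by
        rw [Function.comp_apply, ← Equiv.eq_symm_apply])
    rw [hk]
    rcases k with _ | a | j
    · rw [card_starLabel_none]; rfl
    · rw [card_starLabel_inl]
      exact (e₁.symm a).2
    · rw [card_starLabel_inr]
      rfl

/-- The numerical form of the condition on the order `t` of the central clique and the number `m`
of outer cliques. -/
theorem two_mul_sub_one_mul_sub_one_le_mul_iff {t m : ℕ} (ht : 1 ≤ t) (htm : 2 ≤ t + m) :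
    2 * ((t : ℝ) - 1) * (m - 1) ≤ t * m ↔
      (t = 1 ∧ 1 ≤ m) ∨ t = 2 ∨ (t = 3 ∧ m ≤ 4) ∨ (t = 4 ∧ m ≤ 3) ∨ (5 ≤ t ∧ m ≤ 2) := by
  have hcast : 2 * ((t : ℝ) - 1) * (m - 1) ≤ t * m ↔
      2 * ((t : ℤ) - 1) * (m - 1) ≤ t * m := by
    exact_mod_cast Iff.rfl
  rw [hcast]
  -- The inequality reads (t-2)(m-2) ≤ 2: always true for t ≤ 2, and equivalent to m ≤ 2 once t ≥ 5.
  rcases (by omega : t = 1 ∨ t = 2 ∨ t = 3 ∨ t = 4 ∨ 5 ≤ t) with rfl | rfl | rfl | rfl | h5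
  · norm_num; omega
  · norm_num
  · norm_num; omega
  · norm_num; omega
  have hm : 2 * ((t : ℤ) - 1) * (m - 1) ≤ t * m ↔ m ≤ 2 := by
    constructor
    · intro hle
      by_contra! hm
      have h5' : (5 : ℤ) ≤ t := by exact_mod_cast h5
      have hm' : (3 : ℤ) ≤ m := by exact_mod_cast hm
      nlinarith
    · intro hm
      have h5' : (5 : ℤ) ≤ t := by exact_mod_cast h5
      interval_cases m <;> push_cast <;> linarith
  rw [hm]
  omega

theorem IsConeLabelling.card_pos_antiAdjSpectrum_eq_one_iff_cases {V κ : Type*} [Fintype V]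
    [DecidableEq V] [Nontrivial V] [Finite κ] {G : SimpleGraph V} {h : V → Option κ}
    (hG : G.Connected) (H : G.IsConeLabelling h) {t m : ℕ} (ht : Nat.card {u // h u = none} = t)
    (hm : Nat.card κ = m) :
    ((antiAdjSpectrum G).filter (fun x : ℝ => 0 < x)).card = 1 ↔
      (t = 1 ∧ 1 ≤ m) ∨ t = 2 ∨ (t = 3 ∧ m ≤ 4) ∨ (t = 4 ∧ m ≤ 3) ∨ (5 ≤ t ∧ m ≤ 2) := by
  classical
  have := Fintype.ofFinite κ
  have ht1 : 1 ≤ t := by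
    obtain ⟨c, hc⟩ := H.surjective none
    have : Nonempty {u // h u = none} := ⟨⟨c, hc⟩⟩
    exact ht ▸ Nat.card_pos
  -- This excludes t = 1, m = 0, the one-vertex graph, where the inequality holds but no listed case
  -- does.
  have htm : 2 ≤ t + m := by
    by_contra! hlt
    have : IsEmpty κ := (Finite.card_eq_zero_iff).mp (by omega)
    have h2 : Nat.card {u // h u = none} = Nat.card V :=
      Nat.card_congr (Equiv.subtypeUnivEquiv fun u => Subsingleton.elim _ _)
    have h3 := Finite.one_lt_card (α := V)
    omega
  rw [← two_mul_sub_one_mul_sub_one_le_mul_iff ht1 htm,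
    H.card_pos_antiAdjSpectrum_eq_one_iff hG, ← ht, ← hm, Nat.card_eq_fintype_card,
    Nat.card_eq_fintype_card, Fintype.card_subtype]

end SimpleGraph

/-! ### The characterization -/

open SimpleGraph

theorem theorem1p1 {V : Type*} [Fintype V] [DecidableEq V] (G : SimpleGraph V)
    (hG : G.Connected) :
    ((antiAdjSpectrum G).filter (fun x : ℝ => 0 < x)).card = 1 ↔
      ∃ (t₀ p q : ℕ) (t : Fin q → ℕ),
        (∀ j, 2 ≤ t j) ∧
        ((t₀ = 1 ∧ 1 ≤ p + q) ∨
          t₀ = 2 ∨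
          (t₀ = 3 ∧ p + q ≤ 4) ∨
          (t₀ = 4 ∧ p + q ≤ 3) ∨
          (5 ≤ t₀ ∧ p + q ≤ 2)) ∧
        Nonempty (G ≃g starExtension t₀ p t) := by
  constructor
  · intro hcard
    have hA := antiAdjMatrix_isHermitian (G := G)
    have : Nontrivial V := by
      by_contra hV
      rw [not_nontrivial_iff_subsingleton] at hV
      obtain ⟨x, hx⟩ := hA.card_pos_roots_pos.mp (by
        rw [antiAdjSpectrum] at hcard
        omega)
      have h0 : antiAdjMatrix G = 0 := by
        ext u v
        rw [Subsingleton.elim u v, antiAdjMatrix_self, Matrix.zero_apply]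
      simp [h0] at hx
    have htrans : ∀ {a b c : V}, antiAdjMatrix G a b = 0 → antiAdjMatrix G b c = 0 →
        antiAdjMatrix G a c = 0 :=
      hA.apply_eq_zero_trans antiAdjMatrix_self antiAdjMatrix_nonneg
        (exists_antiAdjMatrix_pos hG) hcard.le
    obtain ⟨c, hc⟩ := exists_eccent_le_one hG htrans
    obtain ⟨κ, h, H⟩ := exists_isConeLabelling hc htrans
    have : Finite κ :=
      Finite.of_injective (fun k => (H.surjective (some k)).choose) fun k l hkl => by
        have hk := (H.surjective (some k)).choose_spec
        have hl := (H.surjective (some l)).choose_spec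
        simp only at hkl
        rw [hkl, hl] at hk
        exact (Option.some_injective _ hk).symm
    obtain ⟨p, q, t, ht, hpq, e⟩ := H.exists_iso_starExtension
    exact ⟨_, p, q, t, ht,
      (H.card_pos_antiAdjSpectrum_eq_one_iff_cases hG rfl hpq.symm).mp hcard, e⟩
  · rintro ⟨t₀, p, q, t, ht, hcases, ⟨e⟩⟩
    have h₀ : 1 ≤ t₀ := by omega
    have H := (isConeLabelling_starLabel p h₀ ht).comp_iso e
    have hnone : Nat.card {u // (starLabel t₀ p t ∘ e) u = none} = t₀ :=
      (Nat.card_congr (e.toEquiv.subtypeEquiv fun _ => Iff.rfl)).trans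
        (card_starLabel_none t₀ p t)
    have hpq : Nat.card (Fin p ⊕ Fin q) = p + q := by simp
    -- The order of `G` is at least t₀ and at least p + q + 1, and when t₀ = 1 the case condition
    -- gives p + q ≥ 1.
    have : Nontrivial V := by
      rw [← Finite.one_lt_card_iff_nontrivial]
      by_contra! hV
      have h1 := Nat.card_le_card_of_injective _
        (Subtype.val_injective (p := fun u => (starLabel t₀ p t ∘ e) u = none))
      have h2 := Nat.card_le_card_of_surjective _ H.surjective
      rw [Finite.card_option, hpq] at h2
      rw [hnone] at h1
      omega
    exact (H.card_pos_antiAdjSpectrum_eq_one_iff_cases hG hnone hpq).mpr hcases
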